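/- A real $2\times2\times2$ tensor is an array $T=(t_{ijk})_{i,j,k\in\{0,1\}}\in\mathbb R^2\otimes\mathbb R^2\otimes\mathbb R^2$. Its subrank $Q(T)$ is the largest $r$ for which there are linear maps $\varphi_1,\varphi_2,\varphi_3:\mathbb R^2\to\mathbb R^r$ with $(\varphi_1\otimes\varphi_2\otimes\varphi_3)T=\sum_{j=1}^r e_j\otimes e_j\otimes e_j$, and its rank $R(T)$ is the smallest $r$ for which $T$ is a sum of $r$ tensors $u\otimes v\otimes w$ with $u,v,w\in\mathbb R^2$. A number $r$ is a typical subrank if the set of tensors with $Q(T)=r$ contains a nonempty open subset in the Euclidean topology. Let $$\begin{aligned}\Delta(T)={}&t_{000}^2t_{111}^2+t_{001}^2t_{110}^2+t_{010}^2t_{101}^2+t_{100}^2t_{011}^2\\&-2\bigl(t_{000}t_{001}t_{110}t_{111}+t_{000}t_{010}t_{101}t_{111}+t_{000}t_{100}t_{011}t_{111}+t_{001}t_{010}t_{101}t_{110}+t_{001}t_{100}t_{011}t_{110}+t_{010}t_{100}t_{011}t_{101}\bigr)\\&+4\bigl(t_{000}t_{011}t_{101}t_{110}+t_{001}t_{010}t_{100}t_{111}\bigr)\end{aligned}$$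 be the Cayley hyperdeterminant. **Proposition 4.2.** 1. The typical subranks of real $2\times2\times2$ tensors are exactly $1$ and $2$. 2. If the entries $t_{ijk}$ of $T$ are independent Gaussian random variables with mean $0$ and common variance $v>0$, then $\mathbf P(Q(T)=2)=\frac{\pi}{4}$. 3. For every real $2\times2\times2$ tensor $T$, $Q(T)=2$ if and only if $\Delta(T)>0$. If moreover $\Delta(T)\neq0$ (which excludes only a proper algebraic subset of tensors), then $Q(T)=2$ if and only if $R(T)=2$. -/

import Mathlib

open MeasureTheory ProbabilityTheory
open scoped NNReal

/-- Real tensors of format `n₁ × n₂ × n₃`, i.e. elements of `ℝ^n₁ ⊗ ℝ^n₂ ⊗ ℝ^n₃`, given by their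
coordinates in the standard basis. The topology is the product (Euclidean) topology. -/
abbrev RealTensor (n₁ n₂ n₃ : ℕ) : Type := Fin n₁ → Fin n₂ → Fin n₃ → ℝ

namespace RealTensor

variable {n₁ n₂ n₃ : ℕ}

/-- `(φ₁ ⊗ φ₂ ⊗ φ₃) T` for linear maps `φ₁ : ℝ^n₁ → ℝ^m₁`, `φ₂ : ℝ^n₂ → ℝ^m₂`, `φ₃ : ℝ^n₃ → ℝ^m₃`
given by their matrices `A`, `B`, `C`. -/
def transform {m₁ m₂ m₃ : ℕ} (A : Matrix (Fin m₁) (Fin n₁) ℝ) (B : Matrix (Fin m₂) (Fin n₂) ℝ)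
    (C : Matrix (Fin m₃) (Fin n₃) ℝ) (T : RealTensor n₁ n₂ n₃) : RealTensor m₁ m₂ m₃ :=
  fun a b c => ∑ i, ∑ j, ∑ k, A a i * B b j * C c k * T i j k

/-- The `r`-th unit tensor `I_r = ∑_j e_j ⊗ e_j ⊗ e_j`. -/
def unit (r : ℕ) : RealTensor r r r :=
  fun a b c => if a = b ∧ b = c then 1 else 0

/-- The subrank `Q(T)`: the largest `r` such that `T` can be mapped to `I_r` by a triple of linear
maps. (The set always contains `0` and is bounded above by each `nᵢ`, so the supremum
is a maximum.) -/
noncomputable def subrank (T : RealTensor n₁ n₂ n₃) : ℕ :=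
  sSup {r : ℕ | ∃ (A : Matrix (Fin r) (Fin n₁) ℝ) (B : Matrix (Fin r) (Fin n₂) ℝ)
    (C : Matrix (Fin r) (Fin n₃) ℝ), transform A B C T = unit r}

/-- The (real) rank `R(T)`: the smallest `r` such that `T` is a sum of `r` tensors of the form
`u ⊗ v ⊗ w`. -/
noncomputable def rank (T : RealTensor n₁ n₂ n₃) : ℕ :=
  sInf {r : ℕ | ∃ (u : Fin r → Fin n₁ → ℝ) (v : Fin r → Fin n₂ → ℝ) (w : Fin r → Fin n₃ → ℝ),
    ∀ i j k, T i j k = ∑ l, u l i * v l j * w l k}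

/-- `r` is a typical subrank of the format `n₁ × n₂ × n₃` if the set of tensors of subrank `r`
contains a nonempty open subset. -/
def IsTypicalSubrank (n₁ n₂ n₃ r : ℕ) : Prop :=
  ∃ U : Set (RealTensor n₁ n₂ n₃), IsOpen U ∧ U.Nonempty ∧ U ⊆ {T | subrank T = r}

/-- The Cayley hyperdeterminant of a `2 × 2 × 2` tensor. -/
def hyperdet (T : RealTensor 2 2 2) : ℝ :=
  T 0 0 0 ^ 2 * T 1 1 1 ^ 2 + T 0 0 1 ^ 2 * T 1 1 0 ^ 2
    + T 0 1 0 ^ 2 * T 1 0 1 ^ 2 + T 1 0 0 ^ 2 * T 0 1 1 ^ 2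
    - 2 * (T 0 0 0 * T 0 0 1 * T 1 1 0 * T 1 1 1 + T 0 0 0 * T 0 1 0 * T 1 0 1 * T 1 1 1
      + T 0 0 0 * T 1 0 0 * T 0 1 1 * T 1 1 1 + T 0 0 1 * T 0 1 0 * T 1 0 1 * T 1 1 0
      + T 0 0 1 * T 1 0 0 * T 0 1 1 * T 1 1 0 + T 0 1 0 * T 1 0 0 * T 0 1 1 * T 1 0 1)
    + 4 * (T 0 0 0 * T 0 1 1 * T 1 0 1 * T 1 1 0 + T 0 0 1 * T 0 1 0 * T 1 0 0 * T 1 1 1)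

end RealTensor

/-! The form det(x T₀ + y T₁) in the slices of `T` has discriminant Δ. If Δ > 0, the pencil contains
two independent singular matrices, so `T` is a sum of two simple tensors, i.e. the image of `unit 2`
under three matrices. Since Δ is multiplied by the squares of their determinants
(`hyperdet_transform`), all three are invertible, and inverting them gives subrank 2. The same
scaling rule and Δ(`unit 2`) = 1 give the converse and the comparison with rank.

For the probability, read the slices as quaternions α, β. Then Δ = |Im(αβ̄)|² − ⟨Im(αβ̄), i⟩² −
⟨Im(ᾱβ), j⟩² (`hyperdet_eq_pairDisc`), and the law of (α, β) is invariant under q ↦ l q r for unit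
l, r. Randomise l and r independently with α, β fixed: l only rotates Im(αβ̄) and r only rotates
Im(ᾱβ), two vectors of equal length, so up to a positive factor Δ becomes 1 − X² − Y²
(`pairDisc_mul`). By Archimedes' theorem on the sphere (`measurePreserving_ratio`), X and Y are
independent and uniform on [−1, 1]. Thus π/4 is the area of the unit disc divided by that of the
square. -/

namespace RealTensor

/-! ### Restrictions to unit tensors and elementary bounds on the subrank -/

section Subrank

variable {n₁ n₂ n₃ : ℕ}

theorem transform_comp {m₁ m₂ m₃ k₁ k₂ k₃ : ℕ}
    (A' : Matrix (Fin k₁) (Fin m₁) ℝ) (B' : Matrix (Fin k₂) (Fin m₂) ℝ)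
    (C' : Matrix (Fin k₃) (Fin m₃) ℝ) (A : Matrix (Fin m₁) (Fin n₁) ℝ)
    (B : Matrix (Fin m₂) (Fin n₂) ℝ) (C : Matrix (Fin m₃) (Fin n₃) ℝ) (T : RealTensor n₁ n₂ n₃) :
    transform A' B' C' (transform A B C T) = transform (A' * A) (B' * B) (C' * C) T := by
  funext a b c
  simp only [transform, Matrix.mul_apply]
  calc _ = ∑ p : Fin m₁ × Fin m₂ × Fin m₃, ∑ q : Fin n₁ × Fin n₂ × Fin n₃,
        A' a p.1 * A p.1 q.1 * (B' b p.2.1 * B p.2.1 q.2.1) * (C' c p.2.2 * C p.2.2 q.2.2) *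
          T q.1 q.2.1 q.2.2 := by
        simp only [Fintype.sum_prod_type, Finset.mul_sum]
        refine Finset.sum_congr rfl fun _ _ => Finset.sum_congr rfl fun _ _ =>
          Finset.sum_congr rfl fun _ _ => Finset.sum_congr rfl fun _ _ =>
          Finset.sum_congr rfl fun _ _ => Finset.sum_congr rfl fun _ _ => ?_
        ring
    _ = ∑ q : Fin n₁ × Fin n₂ × Fin n₃, ∑ p : Fin m₁ × Fin m₂ × Fin m₃,
        A' a p.1 * A p.1 q.1 * (B' b p.2.1 * B p.2.1 q.2.1) * (C' c p.2.2 * C p.2.2 q.2.2) *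
          T q.1 q.2.1 q.2.2 := Finset.sum_comm
    _ = _ := by
        simp only [Fintype.sum_prod_type, Finset.sum_mul_sum, ← Finset.sum_mul]
        simp only [← Finset.mul_sum, ← Finset.sum_mul]

theorem transform_one (T : RealTensor n₁ n₂ n₃) : transform 1 1 1 T = T := by
  funext a b c
  simp [transform, Matrix.one_apply, Finset.sum_ite_eq]

/-- The set of `r` such that `T` restricts to the `r`-th unit tensor. -/
def unitRestrictions (T : RealTensor n₁ n₂ n₃) : Set ℕ :=
  {r : ℕ | ∃ (A : Matrix (Fin r) (Fin n₁) ℝ) (B : Matrix (Fin r) (Fin n₂) ℝ)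
    (C : Matrix (Fin r) (Fin n₃) ℝ), transform A B C T = unit r}

/-- The rows of `A` are independent: applying a linear relation among them to the entries (a, b, b)
of the unit tensor isolates its coefficient at b. -/
theorem le_of_mem_unitRestrictions {T : RealTensor n₁ n₂ n₃} {r : ℕ}
    (h : r ∈ unitRestrictions T) : r ≤ n₁ := by
  obtain ⟨A, B, C, h⟩ := h
  suffices hA : LinearIndependent ℝ A.row by simpa using hA.fintype_card_le_finrank
  refine Fintype.linearIndependent_iff.2 ?_
  intro g hg b
  calc g b = ∑ a, g a * transform A B C T a b b := by simp [h, unit]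
    _ = ∑ i, ∑ a, g a * A a i * ∑ j, ∑ k, B b j * C b k * T i j k := by
        rw [Finset.sum_comm]
        simp only [transform, Finset.mul_sum, mul_assoc]
    _ = 0 := by
        refine Finset.sum_eq_zero fun i _ => ?_
        rw [← Finset.sum_mul]
        have := congrFun hg i
        simp only [Finset.sum_apply, Pi.smul_apply, smul_eq_mul, Pi.zero_apply, Matrix.row] at this
        rw [this, zero_mul]

theorem zero_mem_unitRestrictions (T : RealTensor n₁ n₂ n₃) : 0 ∈ unitRestrictions T :=
  ⟨0, 0, 0, funext fun a => a.elim0⟩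

theorem bddAbove_unitRestrictions (T : RealTensor n₁ n₂ n₃) : BddAbove (unitRestrictions T) :=
  ⟨n₁, fun _ => le_of_mem_unitRestrictions⟩

theorem subrank_mem (T : RealTensor n₁ n₂ n₃) : T.subrank ∈ unitRestrictions T :=
  Nat.sSup_mem ⟨0, zero_mem_unitRestrictions T⟩ (bddAbove_unitRestrictions T)

theorem subrank_le (T : RealTensor n₁ n₂ n₃) : T.subrank ≤ n₁ :=
  le_of_mem_unitRestrictions (subrank_mem T)

theorem le_subrank {T : RealTensor n₁ n₂ n₃} {r : ℕ} (h : r ∈ unitRestrictions T) :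
    r ≤ T.subrank :=
  le_csSup (bddAbove_unitRestrictions T) h

theorem one_le_subrank {T : RealTensor n₁ n₂ n₃} (hT : T ≠ 0) : 1 ≤ T.subrank := by
  obtain ⟨i, j, k, h⟩ : ∃ i j k, T i j k ≠ 0 := by
    by_contra! h
    exact hT (by funext i j k; exact h i j k)
  refine le_subrank ⟨fun _ => Pi.single i (T i j k)⁻¹, fun _ => Pi.single j 1,
    fun _ => Pi.single k 1, ?_⟩
  funext a b c
  have hab : a = b ∧ b = c := ⟨Subsingleton.elim _ _, Subsingleton.elim _ _⟩
  simp [transform, unit, hab, Pi.single_apply, h]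

end Subrank

/-! ### The hyperdeterminant as discriminant and relative invariant -/

section Hyperdet

theorem transform_eq_comp (A B C : Matrix (Fin 2) (Fin 2) ℝ) (T : RealTensor 2 2 2) :
    transform A B C T =
      transform A (1 : Matrix (Fin 2) (Fin 2) ℝ) (1 : Matrix (Fin 2) (Fin 2) ℝ)
        (transform (1 : Matrix (Fin 2) (Fin 2) ℝ) B (1 : Matrix (Fin 2) (Fin 2) ℝ)
          (transform 1 1 C T)) := by
  simp [transform_comp]

/-- Acting in one direction at a time keeps each polynomial identity small enough for `ring`. -/
theorem hyperdet_transform (A B C : Matrix (Fin 2) (Fin 2) ℝ) (T : RealTensor 2 2 2) :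
    hyperdet (transform A B C T) = A.det ^ 2 * B.det ^ 2 * C.det ^ 2 * hyperdet T := by
  have h1 (T : RealTensor 2 2 2) : hyperdet (transform A 1 1 T) = A.det ^ 2 * hyperdet T := by
    simp [hyperdet, transform, Fin.sum_univ_two, Matrix.det_fin_two, Matrix.one_apply]
    ring
  have h2 (T : RealTensor 2 2 2) : hyperdet (transform 1 B 1 T) = B.det ^ 2 * hyperdet T := by
    simp [hyperdet, transform, Fin.sum_univ_two, Matrix.det_fin_two, Matrix.one_apply]
    ring
  have h3 (T : RealTensor 2 2 2) : hyperdet (transform 1 1 C T) = C.det ^ 2 * hyperdet T := by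
    simp [hyperdet, transform, Fin.sum_univ_two, Matrix.det_fin_two, Matrix.one_apply]
    ring
  rw [transform_eq_comp, h1, h2, h3]
  ring

theorem hyperdet_unit : hyperdet (unit 2) = 1 := by
  simp [hyperdet, unit]

theorem exists_eq_mul_of_det_eq_zero {a b c d : ℝ} (h : a * d = b * c) :
    ∃ u v : Fin 2 → ℝ, a = u 0 * v 0 ∧ b = u 0 * v 1 ∧ c = u 1 * v 0 ∧ d = u 1 * v 1 := by
  by_cases ha : a = 0
  · subst ha
    have : b = 0 ∨ c = 0 := by simpa using h.symm
    rcases this with rfl | rfl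
    · exact ⟨![0, 1], ![c, d], by simp⟩
    · exact ⟨![b, d], ![0, 1], by simp⟩
  · refine ⟨![1, c / a], ![a, b], ?_⟩
    simp
    constructor <;> field_simp
    linarith

/-- A tensor with two independent singular slices in its first direction is a sum of two
simple tensors. -/
theorem exists_decomposition_of_slices {T : RealTensor 2 2 2} {M N : Fin 2 → Fin 2 → ℝ}
    (hM : M 0 0 * M 1 1 = M 0 1 * M 1 0) (hN : N 0 0 * N 1 1 = N 0 1 * N 1 0)
    {x y : Fin 2 → ℝ} (h : ∀ i j k, T i j k = x i * M j k + y i * N j k) :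
    ∃ u v w : Fin 2 → Fin 2 → ℝ, ∀ i j k, T i j k = ∑ l, u l i * v l j * w l k := by
  obtain ⟨u, v, h1, h2, h3, h4⟩ := exists_eq_mul_of_det_eq_zero hM
  obtain ⟨u', v', h1', h2', h3', h4'⟩ := exists_eq_mul_of_det_eq_zero hN
  refine ⟨![x, y], ![u, u'], ![v, v'], fun i j k => ?_⟩
  rw [h]
  fin_cases j <;> fin_cases k <;> simp [h1, h2, h3, h4, h1', h2', h3', h4', mul_assoc]

/-- The form A x² + B x y + C y² = det(x T₀ + y T₁) has discriminant Δ, so Δ > 0 gives two distinct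
real roots. The corresponding singular matrices span the pencil, and each is a simple tensor. -/
theorem exists_decomposition {T : RealTensor 2 2 2} (hT : 0 < hyperdet T) :
    ∃ u v w : Fin 2 → Fin 2 → ℝ, ∀ i j k, T i j k = ∑ l, u l i * v l j * w l k := by
  set A := T 0 0 0 * T 0 1 1 - T 0 0 1 * T 0 1 0 with hA
  set C := T 1 0 0 * T 1 1 1 - T 1 0 1 * T 1 1 0 with hC
  set B := T 0 0 0 * T 1 1 1 + T 1 0 0 * T 0 1 1 - T 0 0 1 * T 1 1 0 - T 1 0 1 * T 0 1 0 with hB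
  have hD : hyperdet T = B ^ 2 - 4 * A * C := by rw [hA, hB, hC, hyperdet]; ring
  rw [hD] at hT
  have hdet (x y : ℝ) (h : A * x ^ 2 + B * x * y + C * y ^ 2 = 0) :
      (x * T 0 0 0 + y * T 1 0 0) * (x * T 0 1 1 + y * T 1 1 1) =
        (x * T 0 0 1 + y * T 1 0 1) * (x * T 0 1 0 + y * T 1 1 0) := by
    rw [hA, hB, hC] at h
    linear_combination h
  by_cases hA0 : A = 0
  · have hB0 : B ≠ 0 := by
      rintro h
      simp [hA0, h] at hT
    -- Here the form is y (B x + C y), with roots (1, 0) and (−C, B).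
    refine exists_decomposition_of_slices (M := fun j k => 1 * T 0 j k + 0 * T 1 j k)
      (N := fun j k => (-C) * T 0 j k + B * T 1 j k) (hdet 1 0 (by simp [hA0]))
      (hdet (-C) B (by rw [hA0]; ring)) (x := ![1, C / B]) (y := ![0, 1 / B]) fun i j k => ?_
    fin_cases i
    · simp
    · simp
      field_simp
      ring
  · set s := √(B ^ 2 - 4 * A * C) with hs
    have hs0 : s ≠ 0 := (Real.sqrt_pos.2 hT).ne'
    have hs2 : s ^ 2 = B ^ 2 - 4 * A * C := Real.sq_sqrt hT.le
    -- The roots are (−B ± s, 2A) by the quadratic formula; `x` and `y` invert this change of basis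
    -- of the pencil.
    refine exists_decomposition_of_slices (M := fun j k => (-B + s) * T 0 j k + 2 * A * T 1 j k)
      (N := fun j k => (-B - s) * T 0 j k + 2 * A * T 1 j k) (hdet _ _ ?_) (hdet _ _ ?_)
      (x := ![1 / (2 * s), (B + s) / (4 * A * s)])
      (y := ![-1 / (2 * s), (s - B) / (4 * A * s)]) fun i j k => ?_
    · linear_combination A * hs2
    · linear_combination A * hs2
    · fin_cases i
      · simp
        field_simp
        ring
      · simp
        field_simp
        ring

theorem eq_transform_unit {T : RealTensor 2 2 2} {u v w : Fin 2 → Fin 2 → ℝ}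
    (h : ∀ i j k, T i j k = ∑ l, u l i * v l j * w l k) :
    T = transform (Matrix.of u).transpose (Matrix.of v).transpose (Matrix.of w).transpose
      (unit 2) := by
  funext i j k
  rw [h]
  simp [transform, unit, Fin.sum_univ_two]

theorem hyperdet_nonneg_of_decomposition {T : RealTensor 2 2 2} {u v w : Fin 2 → Fin 2 → ℝ}
    (h : ∀ i j k, T i j k = ∑ l, u l i * v l j * w l k) : 0 ≤ hyperdet T := by
  rw [eq_transform_unit h, hyperdet_transform, hyperdet_unit]
  positivity

theorem two_mem_unitRestrictions_iff (T : RealTensor 2 2 2) :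
    2 ∈ unitRestrictions T ↔ 0 < hyperdet T := by
  constructor
  · rintro ⟨A, B, C, h⟩
    have h1 : A.det ^ 2 * B.det ^ 2 * C.det ^ 2 * hyperdet T = 1 := by
      rw [← hyperdet_transform, h, hyperdet_unit]
    by_contra! h0
    have : A.det ^ 2 * B.det ^ 2 * C.det ^ 2 * hyperdet T ≤ 0 :=
      mul_nonpos_of_nonneg_of_nonpos (by positivity) h0
    linarith
  · intro hT
    obtain ⟨u, v, w, h⟩ := exists_decomposition hT
    have hu := eq_transform_unit h
    set U := (Matrix.of u).transpose
    set V := (Matrix.of v).transpose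
    set W := (Matrix.of w).transpose
    rw [hu, hyperdet_transform, hyperdet_unit] at hT
    have hU : IsUnit U.det := by
      rw [isUnit_iff_ne_zero]; rintro h; simp [h] at hT
    have hV : IsUnit V.det := by
      rw [isUnit_iff_ne_zero]; rintro h; simp [h] at hT
    have hW : IsUnit W.det := by
      rw [isUnit_iff_ne_zero]; rintro h; simp [h] at hT
    refine ⟨U⁻¹, V⁻¹, W⁻¹, ?_⟩
    rw [hu, transform_comp, Matrix.nonsing_inv_mul _ hU, Matrix.nonsing_inv_mul _ hV,
      Matrix.nonsing_inv_mul _ hW, transform_one]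

theorem subrank_eq_two_iff (T : RealTensor 2 2 2) : subrank T = 2 ↔ 0 < hyperdet T := by
  rw [← two_mem_unitRestrictions_iff]
  exact ⟨fun h => by simpa only [h] using subrank_mem T, fun h => (subrank_le T).antisymm (le_subrank h)⟩

theorem rank_eq_two_iff {T : RealTensor 2 2 2} (hT : hyperdet T ≠ 0) :
    rank T = 2 ↔ 0 < hyperdet T := by
  constructor
  · intro h
    have hmem := Nat.sInf_mem (Nat.nonempty_of_sInf_eq_succ (show rank T = 1 + 1 from h))
    change rank T ∈ _ at hmem
    rw [h] at hmem
    obtain ⟨u, v, w, h⟩ := hmem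
    exact (hyperdet_nonneg_of_decomposition h).lt_of_ne' hT
  · intro h
    obtain ⟨u, v, w, hd⟩ := exists_decomposition h
    refine le_antisymm (Nat.sInf_le ⟨u, v, w, hd⟩) (le_csInf ⟨2, u, v, w, hd⟩ ?_)
    rintro r ⟨u, v, w, hr⟩
    by_contra! hlt
    apply hT
    interval_cases r
    · simp at hr
      simp [hyperdet, hr]
    · simp at hr
      simp only [hyperdet, hr]
      ring

theorem continuous_hyperdet : Continuous hyperdet := by
  unfold hyperdet
  fun_prop

theorem isTypicalSubrank_iff (r : ℕ) : IsTypicalSubrank 2 2 2 r ↔ r = 1 ∨ r = 2 := by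
  constructor
  · rintro ⟨U, hU, ⟨T, hT⟩, hsub⟩
    have hle : r ≤ 2 := hsub hT ▸ subrank_le T
    suffices r ≠ 0 by omega
    rintro rfl
    have hU0 : U ⊆ {0} := fun S hS => by
      by_contra hS0
      have := one_le_subrank hS0
      rw [hsub hS] at this
      omega
    have : U = {0} := hU0.antisymm (by rw [← hU0 hT]; simpa using hT)
    exact not_isOpen_singleton (0 : RealTensor 2 2 2) (this ▸ hU)
  · rintro (rfl | rfl)
    · refine ⟨{T | hyperdet T < 0}, isOpen_lt continuous_hyperdet continuous_const, ?_, ?_⟩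
      -- The slices are the identity and a quarter turn: the pencil has determinant x² + y², of
      -- discriminant −4.
      · exact ⟨![![![1, 0], ![0, 1]], ![![0, 1], ![-1, 0]]], by simp [hyperdet]⟩
      · intro T hT
        have hT : hyperdet T < 0 := hT
        have h1 : 1 ≤ subrank T := one_le_subrank (by rintro rfl; simp [hyperdet] at hT)
        have h2 : subrank T ≠ 2 := fun h => by
          rw [subrank_eq_two_iff] at h
          linarith
        have := subrank_le T
        change subrank T = 1
        omega
    · exact ⟨{T | 0 < hyperdet T}, isOpen_lt continuous_const continuous_hyperdet,
        ⟨unit 2, by simp [hyperdet_unit]⟩, fun T hT => (subrank_eq_two_iff T).2 hT⟩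

end Hyperdet

end RealTensor

/-! ### Gaussian vectors, and a uniform law on [−1, 1] -/

section Gaussian

open scoped ENNReal

/-- The product of standard Gaussian measures on `ℝ^ι`. -/
noncomputable def gaussianPi (ι : Type*) [Fintype ι] : Measure (ι → ℝ) :=
  Measure.pi fun _ => gaussianReal 0 1

namespace gaussianPi

variable {ι κ : Type*} [Fintype ι] [Fintype κ]

instance : IsProbabilityMeasure (gaussianPi ι) := by
  unfold gaussianPi; infer_instance

/-- The standard Gaussian measure is invariant under linear isometries. -/
theorem map_linear (f : (ι → ℝ) →ₗ[ℝ] (ι → ℝ)) (hf : ∀ x, ∑ i, f x i ^ 2 = ∑ i, x i ^ 2) :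
    MeasurePreserving f (gaussianPi ι) (gaussianPi ι) := by
  have hfm : Measurable f := f.continuous_of_finiteDimensional.measurable
  refine ⟨hfm, ?_⟩
  let e := WithLp.linearEquiv 2 ℝ (ι → ℝ)
  let g : EuclideanSpace ℝ ι →ₗᵢ[ℝ] EuclideanSpace ℝ ι :=
    ⟨e.symm.toLinearMap ∘ₗ f ∘ₗ e.toLinearMap, fun x => by
      rw [← sq_eq_sq₀ (norm_nonneg _) (norm_nonneg _), EuclideanSpace.real_norm_sq_eq,
        EuclideanSpace.real_norm_sq_eq]
      exact hf _⟩
  have h := stdGaussian_map (g.toLinearIsometryEquiv rfl)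
  rw [← map_pi_eq_stdGaussian] at h
  have h2 := congrArg (Measure.map (WithLp.ofLp : EuclideanSpace ℝ ι → ι → ℝ)) h
  rw [Measure.map_map (by fun_prop) (by fun_prop), Measure.map_map (by fun_prop) (by fun_prop),
    Measure.map_map (by fun_prop) (by fun_prop)] at h2
  have hid : (WithLp.ofLp : EuclideanSpace ℝ ι → ι → ℝ) ∘ WithLp.toLp 2 = id := rfl
  rw [hid, Measure.map_id] at h2
  exact h2

theorem iIndepFun_eval : iIndepFun (fun (i : ι) (x : ι → ℝ) => x i) (gaussianPi ι) :=
  iIndepFun_pi (X := fun _ => id) fun _ => aemeasurable_id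

theorem map_eval (i : ι) : (gaussianPi ι).map (fun x => x i) = gaussianReal 0 1 :=
  (measurePreserving_eval (fun _ : ι => gaussianReal 0 1) i).map_eq

/-- Selecting distinct coordinates of a standard Gaussian vector. -/
theorem map_precomp {g : κ → ι} (hg : g.Injective) :
    MeasurePreserving (fun (x : ι → ℝ) k => x (g k)) (gaussianPi ι) (gaussianPi κ) := by
  refine ⟨by fun_prop, ?_⟩
  have h := (iIndepFun_eval (ι := ι)).precomp hg
  rw [iIndepFun_iff_map_fun_eq_pi_map (fun i => (measurable_pi_apply _).aemeasurable)] at h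
  rw [h]
  simp only [map_eval]
  rfl

theorem map_pair {i j : ι} (hij : i ≠ j) :
    (gaussianPi ι).map (fun x => (x i, x j)) = (gaussianReal 0 1).prod (gaussianReal 0 1) := by
  have h := (iIndepFun_eval (ι := ι)).indepFun hij
  rw [indepFun_iff_map_prod_eq_prod_map_map (measurable_pi_apply _).aemeasurable
    (measurable_pi_apply _).aemeasurable] at h
  rw [h, map_eval, map_eval]

end gaussianPi

theorem lintegral_Ioi_mul_exp_neg_mul_sq {k : ℝ} (hk : 0 < k) {c : ℝ} (hc : 0 ≤ c) :
    ∫⁻ r in Set.Ioi c, ENNReal.ofReal (r * Real.exp (-k * r ^ 2)) =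
      ENNReal.ofReal (Real.exp (-k * c ^ 2) / (2 * k)) := by
  have hderiv : ∀ x ∈ Set.Ici c, HasDerivAt (fun r : ℝ => -Real.exp (-k * r ^ 2) / (2 * k))
      (x * Real.exp (-k * x ^ 2)) x := fun x _ => by
    have h := ((((hasDerivAt_id x).pow 2).const_mul (-k)).exp.neg).div_const (2 * k)
    refine (h.congr_deriv ?_)
    simp only [id, Pi.pow_apply]
    field_simp
    norm_num
    ring
  have hpos : ∀ x ∈ Set.Ioi c, 0 ≤ x * Real.exp (-k * x ^ 2) := fun x hx =>
    mul_nonneg (hc.trans (Set.mem_Ioi.1 hx).le) (Real.exp_nonneg _)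
  have hlim : Filter.Tendsto (fun r : ℝ => -Real.exp (-k * r ^ 2) / (2 * k)) Filter.atTop
      (nhds 0) := by
    have h1 : Filter.Tendsto (fun r : ℝ => -k * r ^ 2) Filter.atTop Filter.atBot :=
      (Filter.tendsto_pow_atTop two_ne_zero).const_mul_atTop_of_neg (neg_lt_zero.2 hk)
    simpa using ((Real.tendsto_exp_atBot.comp h1).neg).div_const (2 * k)
  rw [← ofReal_integral_eq_lintegral_ofReal
    (integrableOn_Ioi_deriv_of_nonneg' hderiv hpos hlim)
    ((ae_restrict_iff' measurableSet_Ioi).2 (ae_of_all _ hpos)),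
    integral_Ioi_of_hasDerivAt_of_nonneg' hderiv hpos hlim]
  congr 1
  ring

/-- Polar coordinates: the angular integral 2π cancels the normalisation of the planar density. -/
theorem lintegral_gaussian_prod_sq {g : ℝ → ℝ≥0∞} (hg : Measurable g) :
    ∫⁻ p, g (p.1 ^ 2 + p.2 ^ 2) ∂((gaussianReal 0 1).prod (gaussianReal 0 1)) =
      ∫⁻ r in Set.Ioi (0 : ℝ), ENNReal.ofReal (r * Real.exp (-(1 / 2) * r ^ 2)) * g (r ^ 2) := by
  have hpdf : Measurable (gaussianPDF 0 1) := measurable_gaussianPDF 0 1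
  rw [gaussianReal_of_var_ne_zero 0 one_ne_zero, prod_withDensity hpdf hpdf,
    ← Measure.volume_eq_prod, lintegral_withDensity_eq_lintegral_mul _ (by fun_prop) (by fun_prop),
    ← lintegral_comp_polarCoord_symm, polarCoord_target, Measure.volume_eq_prod,
    ← Measure.prod_restrict, lintegral_prod _ (by fun_prop)]
  refine setLIntegral_congr_fun measurableSet_Ioi fun r hr => ?_
  have hr : 0 < r := hr
  have h (θ : ℝ) : ENNReal.ofReal r • ((fun p : ℝ × ℝ => gaussianPDF 0 1 p.1 * gaussianPDF 0 1 p.2) *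
      fun p : ℝ × ℝ => g (p.1 ^ 2 + p.2 ^ 2)) (polarCoord.symm (r, θ)) =
      ENNReal.ofReal (r * Real.exp (-(1 / 2) * r ^ 2) / (2 * Real.pi)) * g (r ^ 2) := by
    have h1 : (r * Real.cos θ) ^ 2 + (r * Real.sin θ) ^ 2 = r ^ 2 := by
      linear_combination r ^ 2 * Real.sin_sq_add_cos_sq θ
    simp only [polarCoord_symm_apply, Pi.mul_apply, smul_eq_mul, gaussianPDF, h1]
    rw [← mul_assoc, ← ENNReal.ofReal_mul (gaussianPDFReal_nonneg _ _ _),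
      ← ENNReal.ofReal_mul hr.le]
    congr 2
    simp only [gaussianPDFReal, sub_zero, NNReal.coe_one, mul_one]
    rw [mul_mul_mul_comm, ← Real.exp_add, ← mul_inv, Real.mul_self_sqrt (by positivity)]
    rw [show -(r * Real.cos θ) ^ 2 / 2 + -(r * Real.sin θ) ^ 2 / 2 = -(1 / 2) * r ^ 2 by
      linear_combination (-1 / 2) * h1]
    ring
  simp only [h]
  rw [setLIntegral_const, Real.volume_Ioo, mul_right_comm, ← ENNReal.ofReal_mul (by positivity)]
  congr 2
  field_simp
  ring

theorem gaussian_prod_sq_gt {t : ℝ} (ht : 0 ≤ t) :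
    (gaussianReal 0 1).prod (gaussianReal 0 1) {p | t < p.1 ^ 2 + p.2 ^ 2} =
      ENNReal.ofReal (Real.exp (-t / 2)) := by
  have hm : MeasurableSet {p : ℝ × ℝ | t < p.1 ^ 2 + p.2 ^ 2} :=
    measurableSet_lt (by fun_prop) (by fun_prop)
  rw [← lintegral_indicator_one hm]
  have h := lintegral_gaussian_prod_sq (g := (Set.Ioi t).indicator 1)
    (measurable_one.indicator measurableSet_Ioi)
  have h2 := lintegral_Ioi_mul_exp_neg_mul_sq (k := 1 / 2) (by norm_num) (Real.sqrt_nonneg t)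
  rw [Real.sq_sqrt ht] at h2
  calc _ = _ := h
    _ = ∫⁻ r in Set.Ioi √t, ENNReal.ofReal (r * Real.exp (-(1 / 2) * r ^ 2)) := by
      rw [← lintegral_indicator measurableSet_Ioi, ← lintegral_indicator measurableSet_Ioi]
      congr 1
      funext r
      by_cases hr : √t < r
      · have hr0 : 0 < r := (Real.sqrt_nonneg t).trans_lt hr
        have : t < r ^ 2 := (Real.sqrt_lt' hr0).1 hr
        simp [hr0, hr, this]
      · by_cases hr0 : 0 < r
        · have : ¬ t < r ^ 2 := fun h => hr ((Real.sqrt_lt' hr0).2 h)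
          simp [hr, this]
        · simp [hr, hr0]
    _ = _ := by
      rw [h2]
      congr 1
      rw [show -t / 2 = -(1 / 2) * t by ring]
      simp

theorem lintegral_gaussian_prod_exp {s : ℝ} (hs : 0 ≤ s) :
    ∫⁻ p, ENNReal.ofReal (Real.exp (-s * (p.1 ^ 2 + p.2 ^ 2)))
      ∂((gaussianReal 0 1).prod (gaussianReal 0 1)) = ENNReal.ofReal (1 / (1 + 2 * s)) := by
  rw [lintegral_gaussian_prod_sq (g := fun x => ENNReal.ofReal (Real.exp (-s * x)))
    (by fun_prop)]
  have h := lintegral_Ioi_mul_exp_neg_mul_sq (k := 1 / 2 + s) (by positivity) le_rfl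
  simp only [zero_pow two_ne_zero, mul_zero, Real.exp_zero] at h
  rw [show 2 * (1 / 2 + s) = 1 + 2 * s by ring] at h
  rw [← h]
  refine setLIntegral_congr_fun measurableSet_Ioi fun r hr => ?_
  have hr : 0 < r := hr
  rw [← ENNReal.ofReal_mul (by positivity), mul_assoc, ← Real.exp_add]
  congr 3
  ring

/-- Conditioning on the second pair turns the probability into the Laplace transform of its squared
radius at c/2. -/
theorem gaussian_prod_prod_ratio {c : ℝ} (hc : 0 ≤ c) :
    ((gaussianReal 0 1).prod (gaussianReal 0 1)).prod ((gaussianReal 0 1).prod (gaussianReal 0 1))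
      {q | c * (q.2.1 ^ 2 + q.2.2 ^ 2) < q.1.1 ^ 2 + q.1.2 ^ 2} =
      ENNReal.ofReal (1 / (1 + c)) := by
  have hm : MeasurableSet {q : (ℝ × ℝ) × (ℝ × ℝ) |
      c * (q.2.1 ^ 2 + q.2.2 ^ 2) < q.1.1 ^ 2 + q.1.2 ^ 2} :=
    measurableSet_lt (by fun_prop) (by fun_prop)
  rw [Measure.prod_apply_symm hm]
  have h := lintegral_gaussian_prod_exp (s := c / 2) (by positivity)
  rw [show 1 + 2 * (c / 2) = 1 + c by ring] at h
  rw [← h]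
  refine lintegral_congr fun p => ?_
  have := gaussian_prod_sq_gt (t := c * (p.1 ^ 2 + p.2 ^ 2)) (by positivity)
  rw [show -(c / 2) * (p.1 ^ 2 + p.2 ^ 2) = -(c * (p.1 ^ 2 + p.2 ^ 2)) / 2 by ring, ← this]
  rfl

/-- The uniform probability measure on `[-1, 1]`. -/
noncomputable def uniformSymm : Measure ℝ :=
  (2⁻¹ : ℝ≥0∞) • volume.restrict (Set.Icc (-1) 1)

instance : IsProbabilityMeasure uniformSymm := by
  refine ⟨?_⟩
  simp only [uniformSymm, Measure.smul_apply, Measure.restrict_apply_univ, Real.volume_Icc]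
  norm_num
  exact ENNReal.inv_mul_cancel (by norm_num) (by norm_num)

theorem uniformSymm_Ioi {c : ℝ} (h1 : -1 ≤ c) :
    uniformSymm (Set.Ioi c) = ENNReal.ofReal ((1 - c) / 2) := by
  have : Set.Ioi c ∩ Set.Icc (-1) 1 = Set.Ioc c 1 := by
    ext x
    simp only [Set.mem_inter_iff, Set.mem_Ioi, Set.mem_Icc, Set.mem_Ioc]
    constructor
    · rintro ⟨h, -, h'⟩; exact ⟨h, h'⟩
    · rintro ⟨h, h'⟩; exact ⟨h, by linarith, h'⟩
  simp only [uniformSymm, Measure.smul_apply, Measure.restrict_apply measurableSet_Ioi, this,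
    Real.volume_Ioc, smul_eq_mul]
  rw [ENNReal.ofReal_div_of_pos two_pos, ENNReal.div_eq_inv_mul]
  simp

theorem eq_uniformSymm {μ : Measure ℝ} [IsProbabilityMeasure μ]
    (h : ∀ c, -1 ≤ c → c ≤ 1 → μ (Set.Ioi c) = ENNReal.ofReal ((1 - c) / 2)) :
    μ = uniformSymm := by
  have h1 : ∀ c, μ (Set.Ioi c) = uniformSymm (Set.Ioi c) := by
    have key : ∀ ν : Measure ℝ, IsProbabilityMeasure ν →
        (∀ c, -1 ≤ c → c ≤ 1 → ν (Set.Ioi c) = ENNReal.ofReal ((1 - c) / 2)) →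
        ∀ c, ν (Set.Ioi c) = ENNReal.ofReal ((1 - max (-1) (min c 1)) / 2) := by
      intro ν _ hν c
      rcases lt_or_ge c (-1) with hc | hc
      · have : max (-1) (min c 1) = -1 := max_eq_left ((min_le_left _ _).trans hc.le)
        rw [this]
        refine le_antisymm (by norm_num; exact prob_le_one) ?_
        rw [← hν (-1) le_rfl (by norm_num)]
        exact measure_mono (Set.Ioi_subset_Ioi hc.le)
      · rcases le_total c 1 with hc' | hc'
        · rw [min_eq_left hc', max_eq_right hc, hν c hc hc']
        · rw [min_eq_right hc']
          norm_num
          refine measure_mono_null (Set.Ioi_subset_Ioi hc') ?_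
          rw [hν 1 (by norm_num) le_rfl]
          norm_num
    intro c
    rw [key μ inferInstance h, key _ inferInstance fun c h1 _ => uniformSymm_Ioi h1]
  refine Measure.ext_of_Iic _ _ fun c => ?_
  rw [← Set.compl_Ioi, prob_compl_eq_one_sub measurableSet_Ioi,
    prob_compl_eq_one_sub measurableSet_Ioi, h1]

theorem uniformSymm_prod_disc :
    uniformSymm.prod uniformSymm {p : ℝ × ℝ | p.1 ^ 2 + p.2 ^ 2 < 1} =
      ENNReal.ofReal (Real.pi / 4) := by
  have hm : MeasurableSet {p : ℝ × ℝ | p.1 ^ 2 + p.2 ^ 2 < 1} :=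
    measurableSet_lt (by fun_prop) (by fun_prop)
  have hsub : {p : ℝ × ℝ | p.1 ^ 2 + p.2 ^ 2 < 1} ∩ (Set.Icc (-1) 1 ×ˢ Set.Icc (-1) 1) =
      {p : ℝ × ℝ | p.1 ^ 2 + p.2 ^ 2 < 1} := by
    refine Set.inter_eq_left.2 fun p hp => ?_
    have hp : p.1 ^ 2 + p.2 ^ 2 < 1 := hp
    simp only [Set.mem_prod, Set.mem_Icc, ← abs_le]
    exact ⟨abs_le_one_iff_mul_self_le_one.2 (by nlinarith [sq_nonneg p.2]),
      abs_le_one_iff_mul_self_le_one.2 (by nlinarith [sq_nonneg p.1])⟩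
  have hvol : volume {p : ℝ × ℝ | p.1 ^ 2 + p.2 ^ 2 < 1} = ENNReal.ofReal Real.pi := by
    rw [← Complex.volume_preserving_equiv_real_prod.measure_preimage hm.nullMeasurableSet]
    have : Complex.measurableEquivRealProd ⁻¹' {p : ℝ × ℝ | p.1 ^ 2 + p.2 ^ 2 < 1} =
        Metric.ball (0 : ℂ) 1 := by
      ext z
      simp only [Set.mem_preimage, Set.mem_ofPred_eq, Complex.measurableEquivRealProd_apply,
        mem_ball_zero_iff]
      rw [← sq_lt_one_iff₀ (norm_nonneg z), Complex.sq_norm, Complex.normSq_apply, sq, sq]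
    rw [this, Complex.volume_ball]
    simp [ENNReal.ofReal, NNReal.pi, Real.toNNReal_of_nonneg Real.pi_pos.le]
    rfl
  rw [uniformSymm, Measure.prod_smul_left, Measure.prod_smul_right, Measure.prod_restrict,
    Measure.smul_apply, Measure.smul_apply, Measure.restrict_apply hm, hsub,
    ← Measure.volume_eq_prod, hvol, smul_eq_mul, smul_eq_mul, ← mul_assoc,
    ENNReal.ofReal_div_of_pos (by norm_num), ENNReal.div_eq_inv_mul]
  congr 1
  rw [← ENNReal.mul_inv (by norm_num) (by norm_num)]
  norm_num

/-- Archimedes' theorem in S³ form. With R, S the squared radii of the two coordinate pairs, (R −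
S)/(R + S) > c means R > S (1 + c)/(1 − c), and `gaussian_prod_prod_ratio` gives this probability (1
− c)/2. -/
theorem measurePreserving_ratio :
    MeasurePreserving (fun x : Fin 4 → ℝ => (x 0 ^ 2 + x 1 ^ 2 - x 2 ^ 2 - x 3 ^ 2) /
      (x 0 ^ 2 + x 1 ^ 2 + x 2 ^ 2 + x 3 ^ 2)) (gaussianPi (Fin 4)) uniformSymm := by
  have hm : Measurable (fun x : Fin 4 → ℝ => (x 0 ^ 2 + x 1 ^ 2 - x 2 ^ 2 - x 3 ^ 2) /
      (x 0 ^ 2 + x 1 ^ 2 + x 2 ^ 2 + x 3 ^ 2)) := by fun_prop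
  refine ⟨hm, ?_⟩
  have hpair : (gaussianPi (Fin 4)).map (fun x => ((x 0, x 1), (x 2, x 3))) =
      ((gaussianReal 0 1).prod (gaussianReal 0 1)).prod
        ((gaussianReal 0 1).prod (gaussianReal 0 1)) := by
    have h := (gaussianPi.iIndepFun_eval (ι := Fin 4)).indepFun_prodMk_prodMk
      (fun i => by fun_prop) 0 1 2 3 (by decide) (by decide) (by decide) (by decide)
    rw [indepFun_iff_map_prod_eq_prod_map_map (by fun_prop) (by fun_prop)] at h
    rw [h, gaussianPi.map_pair (by decide), gaussianPi.map_pair (by decide)]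
  have : IsProbabilityMeasure ((gaussianPi (Fin 4)).map (fun x : Fin 4 → ℝ =>
    (x 0 ^ 2 + x 1 ^ 2 - x 2 ^ 2 - x 3 ^ 2) / (x 0 ^ 2 + x 1 ^ 2 + x 2 ^ 2 + x 3 ^ 2))) :=
    Measure.isProbabilityMeasure_map hm.aemeasurable
  refine eq_uniformSymm fun c h1 h2 => ?_
  -- The threshold (1 + c)/(1 − c) degenerates at c = 1, where the event is empty.
  rcases h2.eq_or_lt with rfl | h2
  · rw [Measure.map_apply hm measurableSet_Ioi]
    norm_num
    convert measure_empty (μ := gaussianPi (Fin 4))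
    refine Set.eq_empty_of_forall_notMem fun x hx => ?_
    rw [Set.mem_preimage, Set.mem_Ioi] at hx
    refine hx.not_ge ?_
    exact div_le_one_of_le₀ (by nlinarith [sq_nonneg (x 2), sq_nonneg (x 3)]) (by positivity)
  have hc : 0 ≤ (1 + c) / (1 - c) := div_nonneg (by linarith) (by linarith)
  have hS : MeasurableSet {q : (ℝ × ℝ) × (ℝ × ℝ) |
      (1 + c) / (1 - c) * (q.2.1 ^ 2 + q.2.2 ^ 2) < q.1.1 ^ 2 + q.1.2 ^ 2} :=
    measurableSet_lt (by fun_prop) (by fun_prop)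
  have h := gaussian_prod_prod_ratio hc
  rw [← hpair, Measure.map_apply (by fun_prop) hS] at h
  rw [Measure.map_apply hm measurableSet_Ioi]
  rw [show 1 / (1 + (1 + c) / (1 - c)) = (1 - c) / 2 by
    have : 1 - c ≠ 0 := by linarith
    field_simp
    ring] at h
  rw [← h]
  refine measure_congr ?_
  have h0 : ∀ᵐ x ∂(gaussianPi (Fin 4)), 0 < x 0 ^ 2 + x 1 ^ 2 := by
    have hm0 : MeasurableSet {p : ℝ × ℝ | 0 < p.1 ^ 2 + p.2 ^ 2} :=
      measurableSet_lt (by fun_prop) (by fun_prop)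
    have h := gaussian_prod_sq_gt le_rfl
    rw [← gaussianPi.map_pair (ι := Fin 4) (i := 0) (j := 1) (by decide),
      Measure.map_apply (by fun_prop) hm0] at h
    have hm1 : Measurable fun x : Fin 4 → ℝ => (x 0, x 1) := by fun_prop
    exact (mem_ae_iff_prob_eq_one (hm1 hm0)).2 (by rw [h]; simp)
  filter_upwards [h0] with x hx
  have hD : 0 < x 0 ^ 2 + x 1 ^ 2 + x 2 ^ 2 + x 3 ^ 2 := by positivity
  refine propext ?_
  change c < _ ↔ (1 + c) / (1 - c) * (x 2 ^ 2 + x 3 ^ 2) < x 0 ^ 2 + x 1 ^ 2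
  rw [lt_div_iff₀ hD, div_mul_eq_mul_div, div_lt_iff₀ (by linarith)]
  constructor <;> intro h <;> linarith

end Gaussian

/-! ### Quaternionic rotations and the form of the hyperdeterminant -/

section QuaternionForm

open scoped Quaternion ENNReal

namespace Quaternion

/-- The quaternion with coordinate vector `x`. -/
def ofCoord (x : Fin 4 → ℝ) : ℍ[ℝ] := ⟨x 0, x 1, x 2, x 3⟩

@[simp] theorem ofCoord_re (x : Fin 4 → ℝ) : (ofCoord x).re = x 0 := rfl

@[simp] theorem ofCoord_imI (x : Fin 4 → ℝ) : (ofCoord x).imI = x 1 := rfl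

@[simp] theorem ofCoord_imJ (x : Fin 4 → ℝ) : (ofCoord x).imJ = x 2 := rfl

@[simp] theorem ofCoord_imK (x : Fin 4 → ℝ) : (ofCoord x).imK = x 3 := rfl

/-- The coordinate vector of a quaternion. -/
def coord (q : ℍ[ℝ]) : Fin 4 → ℝ := ![q.re, q.imI, q.imJ, q.imK]

@[simp] theorem ofCoord_coord (q : ℍ[ℝ]) : ofCoord (coord q) = q := rfl

theorem normSq_eq_sum (x : Fin 4 → ℝ) : normSq (ofCoord x) = ∑ i, x i ^ 2 := by
  simp [normSq_def', Fin.sum_univ_four]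

theorem normSq_eq_sum_coord (q : ℍ[ℝ]) : normSq q = ∑ i, coord q i ^ 2 := by
  rw [← normSq_eq_sum, ofCoord_coord]

/-- The quaternion unit `i`. -/
def unitI : ℍ[ℝ] := ⟨0, 1, 0, 0⟩

/-- The quaternion unit `j`. -/
def unitJ : ℍ[ℝ] := ⟨0, 0, 1, 0⟩

@[simp] theorem unitI_re : (unitI).re = 0 := rfl

@[simp] theorem unitI_imI : (unitI).imI = 1 := rfl

@[simp] theorem unitI_imJ : (unitI).imJ = 0 := rfl

@[simp] theorem unitI_imK : (unitI).imK = 0 := rfl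

@[simp] theorem unitJ_re : (unitJ).re = 0 := rfl

@[simp] theorem unitJ_imI : (unitJ).imI = 0 := rfl

@[simp] theorem unitJ_imJ : (unitJ).imJ = 1 := rfl

@[simp] theorem unitJ_imK : (unitJ).imK = 0 := rfl

/-- `x ↦ a x b` in coordinates. -/
noncomputable def mulMulCoord (a b : ℍ[ℝ]) : (Fin 4 → ℝ) →ₗ[ℝ] (Fin 4 → ℝ) where
  toFun x := coord (a * ofCoord x * b)
  map_add' x y := by
    have : ofCoord (x + y) = ofCoord x + ofCoord y := rfl
    rw [this, mul_add, add_mul]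
    funext i
    fin_cases i <;> simp [coord]
  map_smul' c x := by
    have : ofCoord (c • x) = c • ofCoord x := rfl
    rw [this, mul_smul_comm, smul_mul_assoc]
    funext i
    fin_cases i <;> simp [coord]

theorem measurePreserving_mulMulCoord {a b : ℍ[ℝ]} (ha : normSq a = 1) (hb : normSq b = 1) :
    MeasurePreserving (mulMulCoord a b) (gaussianPi (Fin 4)) (gaussianPi (Fin 4)) := by
  refine gaussianPi.map_linear _ fun x => ?_
  change ∑ i, coord (a * ofCoord x * b) i ^ 2 = _
  rw [← normSq_eq_sum_coord, map_mul, map_mul, ha, hb, normSq_eq_sum, one_mul, mul_one]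

/-- The normalised quadratic form `⟨e x, x u⟩ / |x|²`. -/
noncomputable def hopfForm (e u x : ℍ[ℝ]) : ℝ := (e * x * star (x * u)).re / normSq x

/-- Since e² = i² = −1, one has (i + e) e = i e − 1 = i (i + e), so a normalised i + e works. It
vanishes only for e = −i, where j serves instead. -/
theorem exists_conj_unitI {e : ℍ[ℝ]} (he : e.re = 0) (he1 : normSq e = 1) :
    ∃ a : ℍ[ℝ], normSq a = 1 ∧ a * e = unitI * a := by
  rw [normSq_def', he] at he1
  by_cases h : unitI + e = 0
  · refine ⟨unitJ, by simp [normSq_def'], ?_⟩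
    rw [eq_neg_of_add_eq_zero_right h]
    ext <;> simp
  · set n := √(normSq (unitI + e)) with hn
    have hpos : 0 < normSq (unitI + e) := normSq_nonneg.lt_of_ne' (normSq_ne_zero.2 h)
    have hn0 : n ≠ 0 := (Real.sqrt_pos.2 hpos).ne'
    have hn2 : n ^ 2 = normSq (unitI + e) := Real.sq_sqrt hpos.le
    refine ⟨n⁻¹ • (unitI + e), ?_, ?_⟩
    · rw [normSq_smul, ← hn2]
      field_simp
    · rw [smul_mul_assoc, mul_smul_comm]
      congr 1
      ext <;> simp [he] <;> nlinarith

/-- The substitution x ↦ a x b̄ moves both axes to i; conjugation by the unit a changes no real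
part. This reduces every pair of axes to the form computed in `hopfForm_unitI`. -/
theorem hopfForm_eq {a b e u : ℍ[ℝ]} (ha : normSq a = 1) (hb : normSq b = 1)
    (hae : a * e = unitI * a) (hbu : b * u = unitI * b) (x : ℍ[ℝ]) :
    hopfForm e u x = hopfForm unitI unitI (a * x * star b) := by
  have h1 : a * (e * x * star (x * u)) * star a =
      unitI * (a * x * star b) * star ((a * x * star b) * unitI) := by
    have hb' : star b * b = 1 := by rw [star_mul_self, hb]; rfl
    have hb2 : b * star b = 1 := by rw [self_mul_star, hb]; rfl
    have h2 : star b * unitI = u * star b := by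
      calc star b * unitI = star b * (unitI * b) * star b := by
            rw [mul_assoc, mul_assoc, hb2, mul_one]
        _ = u * star b := by rw [← hbu, ← mul_assoc, hb', one_mul]
    rw [mul_assoc (a * x), h2]
    simp only [star_mul, star_star]
    calc _ = (a * e) * x * (star u * star x) * star a := by simp only [mul_assoc]
      _ = unitI * a * x * (star b * b) * (star u * star x) * star a := by
            rw [hae, hb', mul_one]
      _ = _ := by simp only [mul_assoc]
  have h3 (q : ℍ[ℝ]) : (a * q * star a).re = normSq a * q.re := by
    rw [normSq_def']
    simp
    ring
  rw [hopfForm, hopfForm, ← h1, h3, ha]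
  simp [ha, hb]

theorem hopfForm_unitI (x : Fin 4 → ℝ) : hopfForm unitI unitI (ofCoord x) =
    (x 0 ^ 2 + x 1 ^ 2 - x 2 ^ 2 - x 3 ^ 2) / (x 0 ^ 2 + x 1 ^ 2 + x 2 ^ 2 + x 3 ^ 2) := by
  rw [hopfForm, normSq_def']
  simp
  ring

theorem measurePreserving_hopfForm {e u : ℍ[ℝ]} (he : e.re = 0) (he1 : normSq e = 1)
    (hu : u.re = 0) (hu1 : normSq u = 1) :
    MeasurePreserving (fun x => hopfForm e u (ofCoord x)) (gaussianPi (Fin 4)) uniformSymm := by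
  obtain ⟨a, ha, hae⟩ := exists_conj_unitI he he1
  obtain ⟨b, hb, hbu⟩ := exists_conj_unitI hu hu1
  have h := measurePreserving_ratio.comp
    (measurePreserving_mulMulCoord ha (show normSq (star b) = 1 by rw [normSq_star, hb]))
  have heq : (fun x => hopfForm e u (ofCoord x)) =
      (fun x : Fin 4 → ℝ => (x 0 ^ 2 + x 1 ^ 2 - x 2 ^ 2 - x 3 ^ 2) /
        (x 0 ^ 2 + x 1 ^ 2 + x 2 ^ 2 + x 3 ^ 2)) ∘ mulMulCoord a (star b) := by
    funext x
    rw [hopfForm_eq ha hb hae hbu, ← ofCoord_coord (a * ofCoord x * star b), hopfForm_unitI]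
    rfl
  rw [heq]
  exact h

/-- `|Im(α β̄)|² - ⟨Im(α β̄), i⟩² - ⟨Im(ᾱ β), j⟩²`. -/
noncomputable def pairDisc (α β : ℍ[ℝ]) : ℝ :=
  normSq (α * star β).im - (α * star β).imI ^ 2 - (star α * β).imJ ^ 2

/-- The two products have equal norm and equal real part. Hence a single length s normalises both
imaginary parts in `pairDisc_mul`. -/
theorem normSq_im_mul_star (α β : ℍ[ℝ]) :
    normSq (star α * β).im = normSq (α * star β).im := by
  simp [normSq_def']
  ring

/-- In αβ̄ the factor r cancels to its norm and l acts by conjugation; in ᾱβ the roles are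
exchanged. The two squares therefore depend on l and r separately, which later yields independence.
-/
theorem pairDisc_mul {l r : ℍ[ℝ]} (α β : ℍ[ℝ]) {s : ℝ} (hs : s ≠ 0)
    (hs2 : s ^ 2 = normSq (α * star β).im) (hl : l ≠ 0) (hr : r ≠ 0) :
    pairDisc (l * α * r) (l * β * r) = (normSq l * normSq r) ^ 2 * s ^ 2 *
      (1 - hopfForm unitI (s⁻¹ • (α * star β).im) l ^ 2
        - hopfForm (s⁻¹ • (star α * β).im) unitJ r ^ 2) := by
  have hP : l * α * r * star (l * β * r) = normSq r • (l * (α * star β) * star l) := by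
    simp only [star_mul]
    calc _ = l * α * (r * star r) * star β * star l := by simp only [mul_assoc]
      _ = _ := by
        rw [self_mul_star, ← coe_commutes]
        simp only [← coe_mul_eq_smul, mul_assoc]
  have hM : star (l * α * r) * (l * β * r) = normSq l • (star r * (star α * β) * r) := by
    simp only [star_mul]
    calc _ = star r * star α * (star l * l) * β * r := by simp only [mul_assoc]
      _ = _ := by
        rw [star_mul_self, ← coe_commutes]
        simp only [← coe_mul_eq_smul, mul_assoc]
  have hI (P : ℍ[ℝ]) : normSq l * hopfForm unitI (s⁻¹ • P.im) l * s = (l * P * star l).imI := by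
    have := normSq_ne_zero.2 hl
    rw [hopfForm, mul_smul_comm, star_smul, mul_smul_comm, re_smul, smul_eq_mul]
    rw [mul_div_cancel₀ _ this, mul_right_comm, inv_mul_cancel₀ hs, one_mul]
    simp
    ring
  have hJ (P : ℍ[ℝ]) : normSq r * hopfForm (s⁻¹ • P.im) unitJ r * s = (star r * P * r).imJ := by
    have := normSq_ne_zero.2 hr
    rw [hopfForm, smul_mul_assoc, smul_mul_assoc, re_smul, smul_eq_mul]
    rw [mul_div_cancel₀ _ this, mul_right_comm, inv_mul_cancel₀ hs, one_mul]
    simp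
    ring
  have hN (P : ℍ[ℝ]) : normSq (l * P * star l).im = normSq l ^ 2 * normSq P.im := by
    simp [normSq_def']
    ring
  rw [pairDisc, hP, hM, im_smul, normSq_smul, hN, ← hs2, imI_smul, imJ_smul, smul_eq_mul,
    smul_eq_mul, ← hI, ← hJ]
  ring

end Quaternion

end QuaternionForm

/-! ### Slices of a tensor as quaternions -/

namespace RealTensor

open Quaternion
open scoped Quaternion

/-- The `i`-th slice of a `2 × 2 × 2` tensor as a quaternion. -/
def slice (T : RealTensor 2 2 2) (i : Fin 2) : ℍ[ℝ] := ⟨T i 0 0, T i 0 1, T i 1 0, T i 1 1⟩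

@[simp] theorem slice_re (T : RealTensor 2 2 2) (i : Fin 2) : (slice T i).re = T i 0 0 := rfl

@[simp] theorem slice_imI (T : RealTensor 2 2 2) (i : Fin 2) : (slice T i).imI = T i 0 1 := rfl

@[simp] theorem slice_imJ (T : RealTensor 2 2 2) (i : Fin 2) : (slice T i).imJ = T i 1 0 := rfl

@[simp] theorem slice_imK (T : RealTensor 2 2 2) (i : Fin 2) : (slice T i).imK = T i 1 1 := rfl

theorem hyperdet_eq_pairDisc (T : RealTensor 2 2 2) :
    hyperdet T = pairDisc (slice T 0) (slice T 1) := by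
  rw [pairDisc, normSq_def', hyperdet]
  simp
  ring

end RealTensor

/-! ### Averaging over quaternion multiplications -/

section GaussianTensor

open Quaternion
open scoped Quaternion ENNReal

namespace Quaternion

theorem continuous_ofCoord : Continuous ofCoord :=
  LinearMap.continuous_of_finiteDimensional
    (⟨⟨ofCoord, fun _ _ => rfl⟩, fun _ _ => by ext <;> simp⟩ : (Fin 4 → ℝ) →ₗ[ℝ] ℍ[ℝ])

theorem continuous_pairDisc : Continuous fun p : ℍ[ℝ] × ℍ[ℝ] => pairDisc p.1 p.2 := by
  have hI := continuous_imI
  have hJ := continuous_imJ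
  have hN := continuous_normSq
  have hm := continuous_im
  unfold pairDisc
  exact ((hN.comp (hm.comp (by fun_prop))).sub ((hI.comp (by fun_prop)).pow 2)).sub
    ((hJ.comp (by fun_prop)).pow 2)

theorem pairDisc_smul (c : ℝ) (α β : ℍ[ℝ]) :
    pairDisc (c • α) (c • β) = c ^ 4 * pairDisc α β := by
  simp [pairDisc, normSq_def']
  ring

theorem ae_ofCoord_ne_zero : ∀ᵐ x ∂gaussianPi (Fin 4), ofCoord x ≠ 0 := by
  have h : ∀ᵐ y ∂gaussianReal 0 1, y ≠ 0 :=
    (gaussianReal_absolutelyContinuous 0 one_ne_zero).ae_le (Measure.ae_ne volume 0)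
  filter_upwards [(measurePreserving_eval (fun _ : Fin 4 => gaussianReal 0 1)
    0).quasiMeasurePreserving.ae h] with x hx h0
  exact hx (congrArg QuaternionAlgebra.re h0)

end Quaternion

namespace RealTensor

/-- The `2 × 2 × 2` tensor with coordinate vector `x`. -/
def ofVector (x : Fin 2 × Fin 2 × Fin 2 → ℝ) : RealTensor 2 2 2 := fun i j k => x (i, j, k)

/-- The linear map replacing each slice `q`, seen as a quaternion, by `l q r`. -/
noncomputable def sliceAction (l r : ℍ[ℝ]) :
    (Fin 2 × Fin 2 × Fin 2 → ℝ) →ₗ[ℝ] (Fin 2 × Fin 2 × Fin 2 → ℝ) where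
  toFun x p := coord (l * slice (ofVector x) p.1 * r) (finProdFinEquiv p.2)
  map_add' x y := by
    have h (i : Fin 2) : slice (ofVector (x + y)) i = slice (ofVector x) i + slice (ofVector y) i := rfl
    funext p
    simp only [h, mul_add, add_mul, Pi.add_apply]
    generalize finProdFinEquiv p.2 = m
    fin_cases m <;> rfl
  map_smul' c x := by
    have h (i : Fin 2) : slice (ofVector (c • x)) i = c • slice (ofVector x) i := by ext <;> simp [ofVector]
    funext p
    simp only [h, mul_smul_comm, smul_mul_assoc, Pi.smul_apply, RingHom.id_apply]
    generalize finProdFinEquiv p.2 = m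
    fin_cases m <;> simp [coord]

theorem slice_sliceAction (l r : ℍ[ℝ]) (x : Fin 2 × Fin 2 × Fin 2 → ℝ) (i : Fin 2) :
    slice (ofVector (sliceAction l r x)) i = l * slice (ofVector x) i * r := rfl

theorem sum_sq_eq_normSq_slice (x : Fin 2 × Fin 2 × Fin 2 → ℝ) :
    ∑ p, x p ^ 2 = ∑ i, normSq (slice (ofVector x) i) := by
  simp [Fintype.sum_prod_type, normSq_def', ofVector]
  ring

theorem measurePreserving_sliceAction {l r : ℍ[ℝ]} (hl : normSq l = 1) (hr : normSq r = 1) :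
    MeasurePreserving (sliceAction l r) (gaussianPi (Fin 2 × Fin 2 × Fin 2))
      (gaussianPi (Fin 2 × Fin 2 × Fin 2)) := by
  refine gaussianPi.map_linear _ fun x => ?_
  simp only [sum_sq_eq_normSq_slice, slice_sliceAction, map_mul, hl, hr, one_mul, mul_one]

theorem continuous_slice_ofVector (i : Fin 2) : Continuous fun x => slice (ofVector x) i := by
  have : (fun x => slice (ofVector x) i) =
      fun x => ofCoord ![x (i, 0, 0), x (i, 0, 1), x (i, 1, 0), x (i, 1, 1)] := rfl
  rw [this]
  exact continuous_ofCoord.comp (by fun_prop)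

theorem measurableSet_hyperdet_pos : MeasurableSet {x | 0 < hyperdet (ofVector x)} := by
  have h : Continuous ofVector := by unfold ofVector; fun_prop
  exact (isOpen_lt continuous_const (continuous_hyperdet.comp h)).measurableSet

/-- Normalising l and r only multiplies `pairDisc` by a positive factor, and unit quaternions
preserve the Gaussian law. So l and r may be Gaussian rather than uniform on the sphere. -/
theorem measure_pairDisc_sliceAction {l r : ℍ[ℝ]} (hl : l ≠ 0) (hr : r ≠ 0) :
    gaussianPi (Fin 2 × Fin 2 × Fin 2)
      {x | 0 < pairDisc (l * slice (ofVector x) 0 * r) (l * slice (ofVector x) 1 * r)} =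
    gaussianPi (Fin 2 × Fin 2 × Fin 2) {x | 0 < hyperdet (ofVector x)} := by
  have hunit {q : ℍ[ℝ]} (hq : q ≠ 0) : normSq (‖q‖⁻¹ • q) = 1 := by
    have := norm_ne_zero_iff.2 hq
    rw [normSq_smul, normSq_eq_norm_mul_self]
    field_simp
  rw [← (measurePreserving_sliceAction (hunit hl) (hunit hr)).measure_preimage
    measurableSet_hyperdet_pos.nullMeasurableSet]
  congr 1
  ext x
  have hc : 0 < (‖l‖⁻¹ * ‖r‖⁻¹) ^ 4 := by
    have := norm_pos_iff.2 hl
    have := norm_pos_iff.2 hr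
    positivity
  change _ ↔ 0 < hyperdet (ofVector (sliceAction _ _ x))
  rw [hyperdet_eq_pairDisc, slice_sliceAction, slice_sliceAction]
  simp only [smul_mul_assoc, mul_smul_comm, smul_smul]
  rw [mul_comm ‖r‖⁻¹, pairDisc_smul, mul_pos_iff_of_pos_left hc]
  rfl

/-- If the imaginary part vanishes, so does that of ᾱβ, and comparing i-components gives t₀₀₀ t₁₀₁ =
t₀₀₁ t₁₀₀. That minor is, up to a factor, the numerator of a `hopfForm` in four Gaussian entries,
whose uniform law has no atom at 0. -/
theorem ae_normSq_im_ne_zero : ∀ᵐ x ∂gaussianPi (Fin 2 × Fin 2 × Fin 2),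
    normSq (slice (ofVector x) 0 * star (slice (ofVector x) 1)).im ≠ 0 := by
  let g : Fin 4 → Fin 2 × Fin 2 × Fin 2 := ![(0, 0, 0), (0, 0, 1), (1, 0, 0), (1, 0, 1)]
  have hg : g.Injective := by decide
  have h0 : ∀ᵐ y ∂uniformSymm, y ≠ 0 :=
    (Measure.smul_absolutelyContinuous.trans
      Measure.restrict_le_self.absolutelyContinuous).ae_le (Measure.ae_ne volume 0)
  have h := ((measurePreserving_hopfForm (e := unitI) (u := unitJ) (by simp)
    (by simp [normSq_def']) (by simp) (by simp [normSq_def'])).comp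
      (gaussianPi.map_precomp hg)).quasiMeasurePreserving.ae h0
  filter_upwards [h] with x hx hN
  apply hx
  have h1 := normSq_eq_zero.1 hN
  have h2 := normSq_eq_zero.1 ((normSq_im_mul_star _ _).trans hN)
  have h1 := congrArg QuaternionAlgebra.imI h1
  have h2 := congrArg QuaternionAlgebra.imI h2
  simp [ofVector] at h1 h2
  rw [Function.comp_apply, hopfForm]
  refine div_eq_zero_iff.2 (Or.inl ?_)
  simp [g]
  linarith

theorem measure_pairDisc_quaternions {x : Fin 2 × Fin 2 × Fin 2 → ℝ}
    (hx : normSq (slice (ofVector x) 0 * star (slice (ofVector x) 1)).im ≠ 0) :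
    (gaussianPi (Fin 4)).prod (gaussianPi (Fin 4))
      {p | 0 < pairDisc (ofCoord p.1 * slice (ofVector x) 0 * ofCoord p.2)
        (ofCoord p.1 * slice (ofVector x) 1 * ofCoord p.2)} = ENNReal.ofReal (Real.pi / 4) := by
  set α := slice (ofVector x) 0
  set β := slice (ofVector x) 1
  have hpos : 0 < normSq (α * star β).im := normSq_nonneg.lt_of_ne' hx
  set s := √(normSq (α * star β).im)
  have hs : s ≠ 0 := (Real.sqrt_pos.2 hpos).ne'
  have hs2 : s ^ 2 = normSq (α * star β).im := Real.sq_sqrt hpos.le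
  have h1 := measurePreserving_hopfForm (e := unitI) (u := s⁻¹ • (α * star β).im) (by simp)
    (by simp [normSq_def']) (by simp) (by rw [normSq_smul, ← hs2]; field_simp)
  have h2 := measurePreserving_hopfForm (e := s⁻¹ • (star α * β).im) (u := unitJ) (by simp)
    (by rw [normSq_smul, normSq_im_mul_star, ← hs2]; field_simp) (by simp) (by simp [normSq_def'])
  have hm : MeasurableSet {p : ℝ × ℝ | p.1 ^ 2 + p.2 ^ 2 < 1} :=
    measurableSet_lt (by fun_prop) (by fun_prop)
  rw [← uniformSymm_prod_disc, ← (h1.prod h2).measure_preimage hm.nullMeasurableSet]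
  refine measure_congr ?_
  filter_upwards [Measure.quasiMeasurePreserving_fst.ae ae_ofCoord_ne_zero,
    Measure.quasiMeasurePreserving_snd.ae ae_ofCoord_ne_zero] with p hl hr
  refine propext ?_
  change 0 < pairDisc _ _ ↔ hopfForm _ _ (ofCoord p.1) ^ 2 + hopfForm _ _ (ofCoord p.2) ^ 2 < 1
  have hc : 0 < (normSq (ofCoord p.1) * normSq (ofCoord p.2)) ^ 2 * s ^ 2 := by
    have := normSq_ne_zero.2 hl
    have := normSq_ne_zero.2 hr
    positivity
  rw [pairDisc_mul α β hs hs2 hl hr, mul_pos_iff_of_pos_left hc]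
  constructor <;> intro h <;> linarith

/-- The hyperdeterminant of a standard Gaussian tensor is positive with probability `π / 4`. -/
theorem gaussianPi_hyperdet_pos :
    gaussianPi (Fin 2 × Fin 2 × Fin 2) {x | 0 < hyperdet (ofVector x)} =
      ENNReal.ofReal (Real.pi / 4) := by
  let S : Set (((Fin 4 → ℝ) × (Fin 4 → ℝ)) × (Fin 2 × Fin 2 × Fin 2 → ℝ)) :=
    {q | 0 < pairDisc (ofCoord q.1.1 * slice (ofVector q.2) 0 * ofCoord q.1.2)
      (ofCoord q.1.1 * slice (ofVector q.2) 1 * ofCoord q.1.2)}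
  have hS : MeasurableSet S := by
    have h1 := continuous_ofCoord
    have h2 := continuous_slice_ofVector
    have h (i : Fin 2) : Continuous
        fun q : ((Fin 4 → ℝ) × (Fin 4 → ℝ)) × (Fin 2 × Fin 2 × Fin 2 → ℝ) =>
          ofCoord q.1.1 * slice (ofVector q.2) i * ofCoord q.1.2 :=
      ((h1.comp (by fun_prop)).mul ((h2 i).comp continuous_snd)).mul (h1.comp (by fun_prop))
    exact (isOpen_lt continuous_const
      (continuous_pairDisc.comp ((h 0).prodMk (h 1)))).measurableSet
  let μ := (gaussianPi (Fin 4)).prod (gaussianPi (Fin 4))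
  let ν := gaussianPi (Fin 2 × Fin 2 × Fin 2)
  calc ν {x | 0 < hyperdet (ofVector x)} = ∫⁻ _, ν {x | 0 < hyperdet (ofVector x)} ∂μ := by simp
    -- Fubini in both orders: for fixed l, r invariance gives the sought probability, while for a
    -- fixed tensor the randomness of l, r gives π/4.
    _ = μ.prod ν S := by
      rw [Measure.prod_apply hS]
      refine lintegral_congr_ae ?_
      filter_upwards [Measure.quasiMeasurePreserving_fst.ae ae_ofCoord_ne_zero,
        Measure.quasiMeasurePreserving_snd.ae ae_ofCoord_ne_zero] with p hl hr
      exact (measure_pairDisc_sliceAction hl hr).symm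
    _ = ∫⁻ _, ENNReal.ofReal (Real.pi / 4) ∂ν := by
      rw [Measure.prod_apply_symm hS]
      refine lintegral_congr_ae ?_
      filter_upwards [ae_normSq_im_ne_zero] with x hx
      exact measure_pairDisc_quaternions hx
    _ = _ := by simp

theorem hyperdet_smul (c : ℝ) (T : RealTensor 2 2 2) : hyperdet (c • T) = c ^ 4 * hyperdet T := by
  simp [hyperdet]
  ring

/-- Rescaling by √v multiplies Δ by v² > 0, so the sign has the same law for every variance. -/
theorem pi_gaussianReal_hyperdet_pos {v : ℝ≥0} (hv : v ≠ 0) :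
    (Measure.pi fun _ : Fin 2 × Fin 2 × Fin 2 => gaussianReal 0 v)
      {x | 0 < hyperdet (ofVector x)} = ENNReal.ofReal (Real.pi / 4) := by
  have hmap : (gaussianReal 0 1).map (fun y => √(v : ℝ) * y) = gaussianReal 0 v := by
    rw [gaussianReal_map_const_mul]
    congr 1
    · simp
    · ext
      simp
  have hpi := Measure.pi_map_pi (ι := Fin 2 × Fin 2 × Fin 2) (μ := fun _ => gaussianReal 0 1)
    (f := fun _ y => √(v : ℝ) * y) (fun _ => by fun_prop)
  simp only [hmap] at hpi
  rw [← hpi, Measure.map_apply (by fun_prop) measurableSet_hyperdet_pos,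
    ← gaussianPi_hyperdet_pos]
  congr 1
  ext x
  have hc : 0 < √(v : ℝ) ^ 4 := by
    have : 0 < (v : ℝ) := NNReal.coe_pos.2 (pos_iff_ne_zero.2 hv)
    positivity
  change 0 < hyperdet (√(v : ℝ) • ofVector x) ↔ _
  rw [hyperdet_smul, mul_pos_iff_of_pos_left hc]
  rfl

theorem measure_subrank_eq_two {Ω : Type*} [MeasurableSpace Ω] (P : Measure Ω)
    [IsProbabilityMeasure P] (t : Fin 2 → Fin 2 → Fin 2 → Ω → ℝ) {v : ℝ≥0} (hv : v ≠ 0)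
    (ht : ∀ i j k, HasLaw (t i j k) (gaussianReal 0 v) P)
    (hind : iIndepFun (fun p : Fin 2 × Fin 2 × Fin 2 => t p.1 p.2.1 p.2.2) P) :
    P {ω | subrank (fun i j k => t i j k ω) = 2} = ENNReal.ofReal (Real.pi / 4) := by
  have hm (p : Fin 2 × Fin 2 × Fin 2) : AEMeasurable (t p.1 p.2.1 p.2.2) P :=
    (ht p.1 p.2.1 p.2.2).aemeasurable
  rw [iIndepFun_iff_map_fun_eq_pi_map hm] at hind
  simp only [(ht _ _ _).map_eq] at hind
  rw [← pi_gaussianReal_hyperdet_pos hv, ← hind,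
    Measure.map_apply_of_aemeasurable (aemeasurable_pi_lambda _ hm) measurableSet_hyperdet_pos]
  congr 1
  ext ω
  exact subrank_eq_two_iff _

end RealTensor

end GaussianTensor

theorem proposition4p2 :
    (∀ r : ℕ, RealTensor.IsTypicalSubrank 2 2 2 r ↔ r = 1 ∨ r = 2) ∧
    (∀ {Ω : Type*} [MeasurableSpace Ω] (P : Measure Ω) [IsProbabilityMeasure P]
      (t : Fin 2 → Fin 2 → Fin 2 → Ω → ℝ) (v : ℝ≥0), v ≠ 0 →
      (∀ i j k, HasLaw (t i j k) (gaussianReal 0 v) P) →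
      iIndepFun (fun p : Fin 2 × Fin 2 × Fin 2 => t p.1 p.2.1 p.2.2) P →
      P {ω | RealTensor.subrank (fun i j k => t i j k ω) = 2} = ENNReal.ofReal (Real.pi / 4)) ∧
    (∀ T : RealTensor 2 2 2,
      (RealTensor.subrank T = 2 ↔ 0 < RealTensor.hyperdet T) ∧
      (RealTensor.hyperdet T ≠ 0 → (RealTensor.subrank T = 2 ↔ RealTensor.rank T = 2))) := by
  refine ⟨RealTensor.isTypicalSubrank_iff, fun P _ t v hv ht hind =>
    RealTensor.measure_subrank_eq_two P t hv ht hind, fun T => ⟨RealTensor.subrank_eq_two_iff T,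
      fun hT => ?_⟩⟩
  rw [RealTensor.subrank_eq_two_iff, RealTensor.rank_eq_two_iff hT]
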